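/- Let $A$ be a unital complex Banach algebra with submultiplicative norm. All Banach $A$-modules are unital left Banach modules with $\|a\cdot x\|\le\|a\|\,\|x\|$, and morphisms are bounded $A$-module maps. A morphism $\psi\colon X_0\to X$ of Banach $A$-modules is *small* if for every morphism $\varphi\colon Y\to X$ of Banach $A$-modules such that $Y\oplus X_0\to X,\ (y,z)\mapsto\varphi(y)+\psi(z)$ is surjective, $\varphi$ itself is surjective. A *contractive monomorphism* is an injective morphism of norm at most $1$; a contractive monomorphism $\alpha\colon Y\to X$ is *maximal* if it is not surjective and, for every non-surjective contractive monomorphism $\beta\colon Z\to X$ and every contractive morphism $\kappa\colon Y\to Z$, the equality $\alpha=\beta\kappa$ implies that $\kappa$ is an isometric isomorphism. The *topological radical* $\operatorname{trad}X$ of a Banach $A$-module $X$ is the intersection of the ranges of all maximal contractive monomorphisms with range in $X$ (it is $X$ if there are none). **Theorem.** Let $X$ be a Banach $A$-module and let $R$ be the Jacobson radical of $A$. Then $\operatorname{trad}X$ is a closed submodule of $X$, it equals the union of the ranges of all small morphisms with range in $X$, and the following hold. (1) If $Y$ is a Banach $A$-module and $\varphi\colon X\to Y$ is a morphism, then $\varphi(\operatorname{trad}X)\subset\operatorname{trad}Y$.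 (2) For $x_0\in X$, the morphism $\tau\colon A\to X,\ a\mapsto a\cdot x_0$, is small if and only if $x_0\in\operatorname{trad}X$. (3) $\overline{R\cdot X}\subset\operatorname{trad}X$, where $R\cdot X$ denotes the linear span of the products $r\cdot x$ with $r\in R$, $x\in X$. (4) $\operatorname{trad}(X/\operatorname{trad}X)=0$. (5) If $Z$ is a closed submodule of $X$ such that $\operatorname{trad}(X/Z)=0$, then $\operatorname{trad}X\subset Z$. -/

import Mathlib

universe u v w

/-!
Conventions. A unital Banach algebra is a complete `NormedRing` with `NormedAlgebra ℂ`
(so `‖a * b‖ ≤ ‖a‖ * ‖b‖`). A unital left Banach module over it is a complete normed complex space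
with a unital module structure over the algebra, compatible with the complex scalars, such that
`‖a • x‖ ≤ ‖a‖ * ‖x‖`. Morphisms are the bounded (that is, continuous) `A`-linear maps
`Y →L[A] X`; they are automatically complex linear.
-/

section

variable {A : Type u} [NormedRing A] [NormedAlgebra ℂ A]
variable {X : Type v} [NormedAddCommGroup X] [NormedSpace ℂ X] [Module A X]

/-- A morphism `ψ : X₀ → X` of Banach modules is small if every morphism `φ : Y → X` such that
`Y ⊕ X₀ → X, (y, z) ↦ φ y + ψ z` is surjective is itself surjective.
(Any `φ` has the same range as the injection of `Y ⧸ ker φ`, whose underlying set can be taken to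
be a subset of `X`; so it is no restriction to take `Y` in the universe of `X`.) -/
def IsSmallMorphism {X₀ : Type w} [NormedAddCommGroup X₀] [Module A X₀] (ψ : X₀ →L[A] X) : Prop :=
  ∀ (Y : Type v) [NormedAddCommGroup Y] [NormedSpace ℂ Y] [CompleteSpace Y]
    [Module A Y] [IsScalarTower ℂ A Y] [IsBoundedSMul A Y] (φ : Y →L[A] X),
    Function.Surjective (φ.coprod ψ) → Function.Surjective φ

/-- A contractive monomorphism: an injective morphism of norm at most one. -/
def IsContractiveMono {Y : Type v} [NormedAddCommGroup Y] [Module A Y] (α : Y →L[A] X) : Prop :=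
  Function.Injective α ∧ ∀ y, ‖α y‖ ≤ ‖y‖

/-- A contractive monomorphism `α : Y → X` is maximal if it is not surjective and, whenever
`α = β ∘ κ` with `β : Z → X` a non-surjective contractive monomorphism and `κ : Y → Z` a
contractive morphism, `κ` is an isometric isomorphism. -/
def IsMaximalContractiveMono {Y : Type v} [NormedAddCommGroup Y] [Module A Y]
    (α : Y →L[A] X) : Prop :=
  IsContractiveMono α ∧ ¬ Function.Surjective α ∧
    ∀ (Z : Type v) [NormedAddCommGroup Z] [NormedSpace ℂ Z] [CompleteSpace Z]
      [Module A Z] [IsScalarTower ℂ A Z] [IsBoundedSMul A Z]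
      (β : Z →L[A] X) (κ : Y →L[A] Z),
      IsContractiveMono β → ¬ Function.Surjective β → (∀ y, ‖κ y‖ ≤ ‖y‖) →
      α = β.comp κ → Isometry κ ∧ Function.Surjective κ

variable (A X)

/-- The union of the ranges of all small morphisms with range in `X`. -/
def smallRangeUnion : Set X :=
  {x | ∃ (X₀ : Type v) (_ : NormedAddCommGroup X₀) (_ : NormedSpace ℂ X₀) (_ : CompleteSpace X₀)
    (_ : Module A X₀) (_ : IsScalarTower ℂ A X₀) (_ : IsBoundedSMul A X₀) (ψ : X₀ →L[A] X),
    IsSmallMorphism ψ ∧ x ∈ Set.range ψ}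

/-- The topological radical of `X`: the intersection of the ranges of all maximal contractive
monomorphisms with range in `X` (the whole of `X` if there are none). -/
def trad : Submodule A X :=
  sInf {N | ∃ (Y : Type v) (_ : NormedAddCommGroup Y) (_ : NormedSpace ℂ Y) (_ : CompleteSpace Y)
    (_ : Module A Y) (_ : IsScalarTower ℂ A Y) (_ : IsBoundedSMul A Y) (α : Y →L[A] X),
    IsMaximalContractiveMono α ∧ N = LinearMap.range (α : Y →ₗ[A] X)}

end

open Function

/-! ### Quotient modules, factorization and the open mapping argument -/

section

variable {A : Type u} [NormedRing A]

/-! The topological radical is the intersection of the closed maximal submodules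
(`trad_eq_sInf_isClosed_isCoatom`); the rest is then module theory plus one analytic fact. That fact
is `mem_of_mem_closure_of_range_sup_span_eq_top`: if `φ(Y) + A x₀ = X`, the open mapping theorem
writes a small `x₀ - m` as `φ y + a x₀` with `‖a‖ < 1`. Hence `(1 - a) x₀` lies in `M`, and `1 - a`
is invertible. So a maximal submodule containing `φ(Y)` is closed. A maximal contractive
monomorphism has maximal range because adjoining any outside vector yields a larger contractive
monomorphism, which must be onto. If `x₀ ∉ φ(Y)`, Zorn's lemma in the cyclic module `X / φ(Y)` gives
a maximal submodule avoiding `x₀`; it is closed, so `x₀` is not in the radical. This links the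
radical to smallness. -/

theorem Submodule.isBoundedSMul_quotient {W : Type*} [NormedAddCommGroup W] [Module A W]
    [IsBoundedSMul A W] (S : Submodule A W) : IsBoundedSMul A (W ⧸ S) := by
  refine IsBoundedSMul.of_norm_smul_le fun a x => ?_
  refine le_of_forall_pos_lt_add fun ε hε => ?_
  have hpos : 0 < ‖a‖ + 1 := by positivity
  obtain ⟨w, rfl, hw⟩ := Submodule.Quotient.norm_mk_lt x (div_pos hε hpos)
  have key : ‖a‖ * (ε / (‖a‖ + 1)) < ε := by
    rw [← mul_div_assoc, div_lt_iff₀ hpos]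
    nlinarith
  calc ‖a • (Submodule.Quotient.mk w : W ⧸ S)‖
      ≤ ‖a • w‖ := Submodule.Quotient.norm_mk_le S (a • w)
    _ ≤ ‖a‖ * ‖w‖ := norm_smul_le a w
    _ ≤ ‖a‖ * (‖(Submodule.Quotient.mk w : W ⧸ S)‖ + ε / (‖a‖ + 1)) := by gcongr
    _ < _ := by rw [mul_add]; linarith

variable [NormedAlgebra ℂ A]

/-- A Banach module whose cardinality fits into the universe `v` has an isometric copy there. -/
theorem exists_isometric_copy (Q : Type*) [Small.{v} Q] [NormedAddCommGroup Q] [NormedSpace ℂ Q]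
    [CompleteSpace Q] [Module A Q] [IsScalarTower ℂ A Q] [IsBoundedSMul A Q] :
    ∃ (Z : Type v) (_ : NormedAddCommGroup Z) (_ : NormedSpace ℂ Z) (_ : CompleteSpace Z)
      (_ : Module A Z) (_ : IsScalarTower ℂ A Z) (_ : IsBoundedSMul A Z) (e : Z ≃ₗ[A] Q),
      ∀ z, ‖e z‖ = ‖z‖ := by
  obtain ⟨Z, ⟨f⟩⟩ := Small.equiv_small.{v} (α := Q)
  let e : Z ≃ Q := f.symm
  let i1 : NormedAddCommGroup Z := e.normedAddCommGroup
  let i2 : NormedSpace ℂ Z := e.normedSpace ℂ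
  let i3 : Module A Z := e.module A
  let E : Z ≃ₗ[A] Q := e.linearEquiv A
  have hE : ∀ z, ‖E z‖ = ‖z‖ := fun _ => rfl
  refine ⟨Z, i1, i2, ?_, i3, ?_, ?_, E, hE⟩
  · exact (completeSpace_congr (e := e)
      (AddMonoidHomClass.isometry_of_norm E hE).isUniformEmbedding).mpr inferInstance
  · refine ⟨fun c a z => e.injective ?_⟩
    have h1 : ∀ (b : A) (z : Z), e (b • z) = b • e z := fun b z => E.map_smul b z
    have h2 : ∀ (b : ℂ) (z : Z), e (b • z) = b • e z := fun b z => (e.linearEquiv ℂ).map_smul b z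
    rw [h1, h2, h1, smul_assoc]
  · refine IsBoundedSMul.of_norm_smul_le fun a z => ?_
    rw [← hE, ← hE, map_smul]
    exact norm_smul_le _ _

variable {X : Type v} [NormedAddCommGroup X] [Module A X]

/-- Epi-mono factorization of a morphism through the quotient by its kernel, realized in the
universe of the target. -/
theorem exists_epi_mono_factorization {W : Type w} [NormedAddCommGroup W] [NormedSpace ℂ W]
    [CompleteSpace W] [Module A W] [IsScalarTower ℂ A W] [IsBoundedSMul A W] (f : W →L[A] X)
    {C : ℝ} (hC0 : 0 ≤ C) (hC : ∀ y, ‖f y‖ ≤ C * ‖y‖) :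
    ∃ (Z : Type v) (_ : NormedAddCommGroup Z) (_ : NormedSpace ℂ Z) (_ : CompleteSpace Z)
      (_ : Module A Z) (_ : IsScalarTower ℂ A Z) (_ : IsBoundedSMul A Z)
      (β : Z →L[A] X) (π : W →L[A] Z), Injective β ∧ Surjective π ∧ f = β.comp π ∧
        (∀ y, ‖π y‖ ≤ ‖y‖) ∧ ∀ z, ‖β z‖ ≤ C * ‖z‖ := by
  let K : Submodule A W := LinearMap.ker (f : W →ₗ[A] X)
  have : IsClosed (K : Set W) := f.isClosed_ker
  have := K.isBoundedSMul_quotient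
  let g : (W ⧸ K) →ₗ[A] X := K.liftQ (f : W →ₗ[A] X) le_rfl
  have hg : Injective g := LinearMap.ker_eq_bot.mp (Submodule.ker_liftQ_eq_bot _ _ _ le_rfl)
  have gC : ∀ q, ‖g q‖ ≤ C * ‖q‖ := by
    intro q
    refine le_of_forall_pos_le_add fun ε hε => ?_
    have hpos : 0 < C + 1 := by positivity
    obtain ⟨y, rfl, hy⟩ := Submodule.Quotient.norm_mk_lt q (div_pos hε hpos)
    have key : C * (ε / (C + 1)) ≤ ε := by
      rw [← mul_div_assoc, div_le_iff₀ hpos]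
      nlinarith
    calc ‖f y‖ ≤ C * ‖y‖ := hC y
      _ ≤ C * (‖(Submodule.Quotient.mk y : W ⧸ K)‖ + ε / (C + 1)) := by gcongr
      _ ≤ _ := by rw [mul_add]; linarith
  have : Small.{v} (W ⧸ K) := small_of_injective hg
  obtain ⟨Z, i1, i2, i3, i4, i5, i6, e, he⟩ := exists_isometric_copy.{u, v} (A := A) (W ⧸ K)
  have hes : ∀ q, ‖e.symm q‖ = ‖q‖ := fun q => by rw [← he, e.apply_symm_apply]
  have hβ : ∀ z, ‖g (e z)‖ ≤ C * ‖z‖ := fun z => (gC _).trans (by rw [he])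
  have hπ : ∀ y, ‖e.symm (K.mkQ y)‖ ≤ ‖y‖ := fun y => by
    rw [hes]; exact Submodule.Quotient.norm_mk_le K y
  refine ⟨Z, i1, i2, i3, i4, i5, i6,
    ⟨g ∘ₗ e.toLinearMap, AddMonoidHomClass.continuous_of_bound (g ∘ₗ e.toLinearMap) C hβ⟩,
    ⟨e.symm.toLinearMap ∘ₗ K.mkQ, AddMonoidHomClass.continuous_of_bound
      (e.symm.toLinearMap ∘ₗ K.mkQ) 1 (fun y => by simpa using hπ y)⟩,
    hg.comp e.injective, e.symm.surjective.comp K.mkQ_surjective, ?_, hπ, hβ⟩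
  ext y
  simp [g]

/-- If `X` is generated by the range of a morphism together with one element `x₀`, then `x₀` does
not lie in the closure of any proper submodule containing that range. -/
theorem mem_of_mem_closure_of_range_sup_span_eq_top [CompleteSpace A] [CompleteSpace X]
    [NormedSpace ℂ X] [IsScalarTower ℂ A X] [IsBoundedSMul A X]
    {Y : Type w} [NormedAddCommGroup Y] [NormedSpace ℂ Y] [CompleteSpace Y]
    [Module A Y] [IsScalarTower ℂ A Y] (φ : Y →L[A] X) {x₀ : X}
    (h : LinearMap.range (φ : Y →ₗ[A] X) ⊔ Submodule.span A {x₀} = ⊤) {M : Submodule A X}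
    (hM : LinearMap.range (φ : Y →ₗ[A] X) ≤ M) (hx : x₀ ∈ closure (M : Set X)) : x₀ ∈ M := by
  -- The open mapping theorem is applied over `ℂ`, since `A` is not a field.
  let F : (Y × A) →L[ℂ] X :=
    (φ.coprod (ContinuousLinearMap.toSpanSingleton A x₀)).restrictScalars ℂ
  have hF : ∀ p, F p = φ p.1 + p.2 • x₀ := fun p => rfl
  have hsurj : Surjective F := by
    intro x
    have hx : x ∈ LinearMap.range (φ : Y →ₗ[A] X) ⊔ Submodule.span A {x₀} := h ▸ trivial
    obtain ⟨_, ⟨y, rfl⟩, _, hz, rfl⟩ := Submodule.mem_sup.mp hx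
    obtain ⟨a, rfl⟩ := Submodule.mem_span_singleton.mp hz
    exact ⟨(y, a), rfl⟩
  obtain ⟨C, hC, hpre⟩ := F.exists_preimage_norm_le hsurj
  -- The radius `C⁻¹` forces the `A`-component of the preimage to have norm below `1`.
  obtain ⟨m, hm, hd⟩ := Metric.mem_closure_iff.mp hx C⁻¹ (by positivity)
  obtain ⟨⟨y, a⟩, hya, hn⟩ := hpre (x₀ - m)
  rw [hF] at hya
  have ha : ‖a‖ < 1 := by
    refine ((norm_snd_le (y, a)).trans hn).trans_lt ?_
    rw [dist_eq_norm] at hd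
    calc C * ‖x₀ - m‖ < C * C⁻¹ := by gcongr
      _ = 1 := mul_inv_cancel₀ hC.ne'
  have h1 : (Units.oneSub a ha : A) • x₀ = m + φ y := by
    rw [Units.val_oneSub, sub_smul, one_smul, sub_eq_iff_eq_add, add_assoc, hya]
    abel
  have h2 : (Units.oneSub a ha : A) • x₀ ∈ M := h1 ▸ M.add_mem hm (hM ⟨y, rfl⟩)
  have := M.smul_mem (↑(Units.oneSub a ha)⁻¹ : A) h2
  rwa [smul_smul, Units.inv_mul, one_smul] at this

end

/-! ### Maximal submodules and maximal contractive monomorphisms -/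

section

/-- `X ⧸ N` is cyclic and nonzero, hence has a maximal submodule; its preimage cannot contain the
generator `x₀`. -/
theorem Submodule.exists_isCoatom_of_sup_span_eq_top {A X : Type*} [Ring A] [AddCommGroup X]
    [Module A X] {N : Submodule A X} {x₀ : X} (h : N ⊔ Submodule.span A {x₀} = ⊤) (hx : x₀ ∉ N) :
    ∃ M : Submodule A X, IsCoatom M ∧ N ≤ M ∧ x₀ ∉ M := by
  have hfin : Module.Finite A (X ⧸ N) := by
    refine ⟨⟨{N.mkQ x₀}, ?_⟩⟩
    rw [Finset.coe_singleton, ← Set.image_singleton, Submodule.span_image, ← top_le_iff,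
      ← Submodule.comap_le_comap_iff_of_surjective N.mkQ_surjective, Submodule.comap_top,
      Submodule.comap_map_mkQ, h]
  have hne : (⊥ : Submodule A (X ⧸ N)) ≠ ⊤ := by
    intro hbt
    have : N.mkQ x₀ ∈ (⊥ : Submodule A (X ⧸ N)) := hbt ▸ trivial
    exact hx ((Submodule.Quotient.mk_eq_zero N).mp this)
  obtain ⟨P, hP, -⟩ := (eq_top_or_exists_le_coatom (⊥ : Submodule A (X ⧸ N))).resolve_left hne
  have hM := (Submodule.isCoatom_comap_iff N.mkQ_surjective).mpr hP
  have hN : N ≤ P.comap N.mkQ := Submodule.le_comap_mkQ N P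
  refine ⟨_, hM, hN, fun hxM => hM.1 (top_le_iff.mp ?_)⟩
  rw [← h]
  exact sup_le hN (by simpa using hxM)

variable {A : Type u} [NormedRing A] {X : Type v} [NormedAddCommGroup X] [Module A X]

theorem surjective_coprod_iff {Y Z : Type*} [NormedAddCommGroup Y] [Module A Y]
    [NormedAddCommGroup Z] [Module A Z] (φ : Y →L[A] X) (ψ : Z →L[A] X) :
    Surjective (φ.coprod ψ) ↔
      LinearMap.range (φ : Y →ₗ[A] X) ⊔ LinearMap.range (ψ : Z →ₗ[A] X) = ⊤ := by
  rw [← LinearMap.range_coprod, LinearMap.range_eq_top]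
  rfl

variable [NormedAlgebra ℂ A]

/-- Smallness depends only on the range, so the source may be replaced by a quotient in another
universe. -/
theorem IsSmallMorphism.of_range_le {Z Z' : Type*} [NormedAddCommGroup Z] [Module A Z]
    [NormedAddCommGroup Z'] [Module A Z'] {ψ : Z →L[A] X} {ψ' : Z' →L[A] X}
    (hψ : IsSmallMorphism ψ)
    (h : LinearMap.range (ψ' : Z' →ₗ[A] X) ≤ LinearMap.range (ψ : Z →ₗ[A] X)) :
    IsSmallMorphism ψ' := by
  intro Y _ _ _ _ _ _ φ hφ
  refine hψ Y φ ?_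
  rw [surjective_coprod_iff, ← top_le_iff] at hφ ⊢
  exact hφ.trans (sup_le_sup_left h _)

/-- The inclusion of a closed maximal submodule is a maximal contractive monomorphism. -/
theorem isMaximalContractiveMono_subtypeL {M : Submodule A X} (hM : IsCoatom M) :
    IsMaximalContractiveMono M.subtypeL := by
  refine ⟨⟨Subtype.val_injective, fun _ => le_rfl⟩, fun hs => hM.1 ?_, ?_⟩
  · exact eq_top_iff.mpr fun x _ => by obtain ⟨m, rfl⟩ := hs x; exact m.2
  intro Z _ _ _ _ _ _ β κ hβ hns hκ hfac
  have hval : ∀ m : M, β (κ m) = m := fun m => (DFunLike.congr_fun hfac m).symm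
  refine ⟨AddMonoidHomClass.isometry_of_norm κ fun m => le_antisymm (hκ m) ?_, fun z => ?_⟩
  · calc ‖m‖ = ‖β (κ m)‖ := by rw [hval]; rfl
      _ ≤ ‖κ m‖ := hβ.2 _
  · have hle : M ≤ LinearMap.range (β : Z →ₗ[A] X) := fun m hm => ⟨κ ⟨m, hm⟩, hval _⟩
    rcases hM.le_iff.mp hle with htop | heq
    · exact absurd (LinearMap.range_eq_top.mp htop) hns
    · have hz : β z ∈ M := heq ▸ (⟨z, rfl⟩ : β z ∈ LinearMap.range (β : Z →ₗ[A] X))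
      exact ⟨⟨β z, hz⟩, hβ.1 (hval _)⟩

variable [CompleteSpace A] [CompleteSpace X] [NormedSpace ℂ X] [IsScalarTower ℂ A X]
  [IsBoundedSMul A X]

/-- The closure of `M` still misses `x₀`, so it is proper and, by maximality, equals `M`. -/
theorem isClosed_of_isCoatom_of_range_le {Y : Type w} [NormedAddCommGroup Y] [NormedSpace ℂ Y]
    [CompleteSpace Y] [Module A Y] [IsScalarTower ℂ A Y] (φ : Y →L[A] X) {x₀ : X}
    (h : LinearMap.range (φ : Y →ₗ[A] X) ⊔ Submodule.span A {x₀} = ⊤) {M : Submodule A X}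
    (hM : IsCoatom M) (hφ : LinearMap.range (φ : Y →ₗ[A] X) ≤ M) : IsClosed (M : Set X) := by
  have hx : x₀ ∉ M.topologicalClosure := by
    intro hx
    have hxM := mem_of_mem_closure_of_range_sup_span_eq_top φ h hφ hx
    exact hM.1 (top_le_iff.mp (h ▸ sup_le hφ (by simpa using hxM)))
  rcases hM.le_iff.mp M.le_topologicalClosure with htop | heq
  · exact absurd (htop ▸ trivial) hx
  · exact heq ▸ M.isClosed_topologicalClosure

omit [CompleteSpace X] [NormedSpace ℂ X] [IsScalarTower ℂ A X] in
theorem IsMaximalContractiveMono.range_sup_span_eq_top_of_norm_le_one {Y : Type v}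
    [NormedAddCommGroup Y] [NormedSpace ℂ Y] [CompleteSpace Y] [Module A Y] [IsScalarTower ℂ A Y]
    [IsBoundedSMul A Y] {α : Y →L[A] X} (hα : IsMaximalContractiveMono α) {x : X} (hx1 : ‖x‖ ≤ 1)
    (hx : x ∉ LinearMap.range (α : Y →ₗ[A] X)) :
    LinearMap.range (α : Y →ₗ[A] X) ⊔ Submodule.span A {x} = ⊤ := by
  -- With the `ℓ¹` norm, `(y, a) ↦ α y + a • x` is contractive because `‖x‖ ≤ 1`.
  let L : WithLp 1 (Y × A) →ₗ[A] X :=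
    ((α : Y →ₗ[A] X).coprod (LinearMap.toSpanSingleton A X x)) ∘ₗ
      (WithLp.linearEquiv 1 A (Y × A)).toLinearMap
  have hL : ∀ p, L p = α p.fst + p.snd • x := fun _ => rfl
  have hb : ∀ p, ‖L p‖ ≤ 1 * ‖p‖ := fun p => by
    rw [one_mul, WithLp.prod_norm_eq_of_L1, hL]
    refine (norm_add_le _ _).trans (add_le_add (hα.1.2 _) ?_)
    exact (norm_smul_le _ _).trans (mul_le_of_le_one_right (norm_nonneg _) hx1)
  obtain ⟨Z, i1, i2, i3, i4, i5, i6, β, π, hβ, hπs, hfac, hπ, hβ1⟩ :=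
    exists_epi_mono_factorization (⟨L, AddMonoidHomClass.continuous_of_bound L 1 hb⟩ :
      WithLp 1 (Y × A) →L[A] X) zero_le_one hb
  have hfac' : ∀ p, β (π p) = α p.fst + p.snd • x := fun p => (DFunLike.congr_fun hfac p).symm
  let ι : Y →ₗ[A] Z :=
    (π : WithLp 1 (Y × A) →ₗ[A] Z) ∘ₗ (WithLp.linearEquiv 1 A (Y × A)).symm.toLinearMap ∘ₗ
      LinearMap.inl A Y A
  have hι : ∀ y, ι y = π (WithLp.toLp 1 (y, 0)) := fun _ => rfl
  have hι1 : ∀ y, ‖ι y‖ ≤ ‖y‖ := fun y => by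
    rw [hι]
    refine (hπ _).trans ?_
    simp
  by_contra hne
  have hns : ¬ Surjective β := fun hs => hne <| by
    refine eq_top_iff.mpr fun z _ => ?_
    obtain ⟨q, rfl⟩ := hs z
    obtain ⟨p, rfl⟩ := hπs q
    rw [hfac']
    exact Submodule.add_mem_sup ⟨_, rfl⟩
      (Submodule.smul_mem _ _ (Submodule.mem_span_singleton_self x))
  obtain ⟨-, hκ⟩ := hα.2.2 Z β
    ⟨ι, AddMonoidHomClass.continuous_of_bound ι 1 fun y => by simpa using hι1 y⟩
    ⟨hβ, fun z => by simpa using hβ1 z⟩ hns hι1 (by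
      ext y
      change α y = β (ι y)
      rw [hι, hfac']
      simp)
  -- Maximality makes `Y → Z` onto, so the class of `(0, 1)`, which `β` sends to `x`, comes from
  -- `Y`.
  obtain ⟨y, hy⟩ := hκ (π (WithLp.toLp 1 (0, 1)))
  refine hx ⟨y, ?_⟩
  have := congrArg β hy
  change β (ι y) = _ at this
  rw [hι, hfac', hfac'] at this
  simpa using this

omit [CompleteSpace X] in
-- Rescaling `x` by the unit `‖x‖⁻¹` changes neither its span nor its being outside the range.
theorem IsMaximalContractiveMono.range_sup_span_eq_top {Y : Type v}
    [NormedAddCommGroup Y] [NormedSpace ℂ Y] [CompleteSpace Y] [Module A Y] [IsScalarTower ℂ A Y]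
    [IsBoundedSMul A Y] {α : Y →L[A] X} (hα : IsMaximalContractiveMono α) {x : X}
    (hx : x ∉ LinearMap.range (α : Y →ₗ[A] X)) :
    LinearMap.range (α : Y →ₗ[A] X) ⊔ Submodule.span A {x} = ⊤ := by
  have hx0 : ‖x‖ ≠ 0 := fun h => hx (by rw [norm_eq_zero.mp h]; exact zero_mem _)
  have hu : IsUnit (algebraMap ℂ A (‖x‖ : ℂ)⁻¹) :=
    (IsUnit.mk0 _ (by simpa using hx0)).map (algebraMap ℂ A)
  rw [← Submodule.span_singleton_smul_eq hu x]
  refine hα.range_sup_span_eq_top_of_norm_le_one ?_ fun h => hx ?_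
  · rw [algebraMap_smul, norm_smul]
    simp [hx0]
  · obtain ⟨r, hr⟩ := hu
    rw [← hr] at h
    simpa [smul_smul] using Submodule.smul_mem _ (↑r⁻¹ : A) h

omit [CompleteSpace X] in
theorem IsMaximalContractiveMono.isCoatom_range {Y : Type v}
    [NormedAddCommGroup Y] [NormedSpace ℂ Y] [CompleteSpace Y] [Module A Y] [IsScalarTower ℂ A Y]
    [IsBoundedSMul A Y] {α : Y →L[A] X} (hα : IsMaximalContractiveMono α) :
    IsCoatom (LinearMap.range (α : Y →ₗ[A] X)) := by
  refine ⟨fun h => hα.2.1 (LinearMap.range_eq_top.mp h), fun N hN => ?_⟩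
  obtain ⟨hle, x, hxN, hx⟩ := SetLike.lt_iff_le_and_exists.mp hN
  rw [← top_le_iff, ← hα.range_sup_span_eq_top hx]
  exact sup_le hle (by simpa using hxN)

theorem IsMaximalContractiveMono.isClosed_range {Y : Type v}
    [NormedAddCommGroup Y] [NormedSpace ℂ Y] [CompleteSpace Y] [Module A Y] [IsScalarTower ℂ A Y]
    [IsBoundedSMul A Y] {α : Y →L[A] X} (hα : IsMaximalContractiveMono α) :
    IsClosed (LinearMap.range (α : Y →ₗ[A] X) : Set X) := by
  obtain ⟨x, -, hx⟩ := SetLike.exists_of_lt hα.isCoatom_range.lt_top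
  exact isClosed_of_isCoatom_of_range_le α (hα.range_sup_span_eq_top hx) hα.isCoatom_range le_rfl

/-- The topological radical is the intersection of the closed maximal submodules. -/
theorem trad_eq_sInf_isClosed_isCoatom :
    trad A X = sInf {M : Submodule A X | IsClosed (M : Set X) ∧ IsCoatom M} := by
  refine congrArg sInf (Set.ext fun N => ⟨?_, ?_⟩)
  · rintro ⟨Y, _, _, _, _, _, _, α, hα, rfl⟩
    exact ⟨hα.isClosed_range, hα.isCoatom_range⟩
  · rintro ⟨hcl, hN⟩
    have : CompleteSpace N := hcl.completeSpace_coe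
    exact ⟨N, inferInstance, inferInstance, this, inferInstance,
      ⟨fun c a x => Subtype.ext (smul_assoc c a (x : X))⟩,
      IsBoundedSMul.of_norm_smul_le fun a x => norm_smul_le a (x : X), N.subtypeL,
      isMaximalContractiveMono_subtypeL hN, by
        ext x; simp⟩

/-! ### Smallness and the properties of the topological radical -/

theorem mem_trad_iff {x : X} :
    x ∈ trad A X ↔ ∀ M : Submodule A X, IsClosed (M : Set X) → IsCoatom M → x ∈ M := by
  rw [trad_eq_sInf_isClosed_isCoatom, Submodule.mem_sInf]
  exact ⟨fun h M h1 h2 => h M ⟨h1, h2⟩, fun h M hM => h M hM.1 hM.2⟩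

theorem isClosed_trad : IsClosed (trad A X : Set X) := by
  rw [trad_eq_sInf_isClosed_isCoatom, Submodule.coe_sInf]
  exact isClosed_biInter fun M hM => hM.1

/-- If a closed maximal `M` missed part of the range, `M` and the range would span `X`, and
smallness would make the inclusion of `M` onto. -/
theorem IsSmallMorphism.range_le_trad {X₀ : Type*} [NormedAddCommGroup X₀] [Module A X₀]
    {ψ : X₀ →L[A] X} (hψ : IsSmallMorphism ψ) : LinearMap.range (ψ : X₀ →ₗ[A] X) ≤ trad A X := by
  intro x hx
  refine mem_trad_iff.mpr fun M hcl hM => ?_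
  by_contra hxM
  have hlt : M < M ⊔ LinearMap.range (ψ : X₀ →ₗ[A] X) :=
    lt_of_le_of_ne le_sup_left fun h => hxM (h ▸ (le_sup_right (a := M)) hx)
  have : CompleteSpace M := hcl.completeSpace_coe
  have : IsScalarTower ℂ A M := ⟨fun c a x => Subtype.ext (smul_assoc c a (x : X))⟩
  have : IsBoundedSMul A M := IsBoundedSMul.of_norm_smul_le fun a x => norm_smul_le a (x : X)
  have hs : Surjective M.subtypeL := hψ M M.subtypeL <| by
    rw [surjective_coprod_iff, ← hM.2 _ hlt]
    congr 1
    ext x; simp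
  obtain ⟨m, rfl⟩ := hs x
  exact hxM m.2

theorem isSmallMorphism_toSpanSingleton_iff {x₀ : X} :
    IsSmallMorphism (ContinuousLinearMap.toSpanSingleton A x₀) ↔ x₀ ∈ trad A X := by
  have hrange : LinearMap.range (ContinuousLinearMap.toSpanSingleton A x₀ : A →ₗ[A] X) =
      Submodule.span A {x₀} := LinearMap.range_toSpanSingleton x₀
  refine ⟨fun h => h.range_le_trad (hrange ▸ Submodule.mem_span_singleton_self x₀), ?_⟩
  intro hx Y _ _ _ _ _ _ φ hφ
  rw [surjective_coprod_iff, hrange] at hφ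
  have hmem : x₀ ∈ LinearMap.range (φ : Y →ₗ[A] X) := by
    by_contra hxφ
    obtain ⟨M, hM, hle, hxM⟩ := Submodule.exists_isCoatom_of_sup_span_eq_top hφ hxφ
    exact hxM (mem_trad_iff.mp hx M (isClosed_of_isCoatom_of_range_le φ hφ hM hle) hM)
  rw [sup_eq_left.mpr (by simpa using hmem)] at hφ
  exact LinearMap.range_eq_top.mp hφ

theorem coe_trad_eq_smallRangeUnion : (trad A X : Set X) = smallRangeUnion A X := by
  ext x
  constructor
  · intro hx
    have hτ := isSmallMorphism_toSpanSingleton_iff.mpr hx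
    -- `A` may live outside the universe of `X`, so it is replaced by its quotient by the
    -- annihilator of `x`.
    obtain ⟨Z, i1, i2, i3, i4, i5, i6, β, π, -, hπ, hfac, -, -⟩ :=
      exists_epi_mono_factorization (ContinuousLinearMap.toSpanSingleton A x) (norm_nonneg x)
        fun a => (norm_smul_le a x).trans_eq (mul_comm _ _)
    have hβ : ∀ a : A, β (π a) = a • x := fun a => (DFunLike.congr_fun hfac a).symm
    refine ⟨Z, i1, i2, i3, i4, i5, i6, β, hτ.of_range_le ?_, π 1, by rw [hβ, one_smul]⟩
    rintro _ ⟨z, rfl⟩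
    obtain ⟨a, rfl⟩ := hπ z
    exact ⟨a, (hβ a).symm⟩
  · rintro ⟨X₀, _, _, _, _, _, _, ψ, hψ, y, rfl⟩
    exact hψ.range_le_trad ⟨y, rfl⟩

/-- The preimage of a closed maximal submodule is closed, and is either maximal or everything. -/
theorem map_mem_trad {Y : Type w} [NormedAddCommGroup Y] [NormedSpace ℂ Y] [CompleteSpace Y]
    [Module A Y] [IsScalarTower ℂ A Y] [IsBoundedSMul A Y] (φ : X →L[A] Y) {x : X}
    (hx : x ∈ trad A X) : φ x ∈ trad A Y := by
  refine mem_trad_iff.mpr fun M hcl hM => ?_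
  rcases Submodule.isCoatom_comap_or_eq_top (φ : X →ₗ[A] Y) hM with h | h
  · exact mem_trad_iff.mp hx (M.comap (φ : X →ₗ[A] Y)) (hcl.preimage φ.continuous) h
  · have : x ∈ M.comap (φ : X →ₗ[A] Y) := h ▸ trivial
    exact this

theorem jacobson_smul_top_le_trad : Ring.jacobson A • (⊤ : Submodule A X) ≤ trad A X :=
  (Ring.jacobson_smul_top_le (R := A) (M := X)).trans fun _ hx =>
    mem_trad_iff.mpr fun M _ hM => Submodule.mem_sInf.mp hx M hM

/-- Every closed maximal submodule contains `trad A X`, so it is the preimage of a closed maximal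
submodule of the quotient. -/
theorem trad_quotient_trad [IsClosed (trad A X : Set X)] : trad A (X ⧸ trad A X) = ⊥ := by
  have := (trad A X).isBoundedSMul_quotient
  refine eq_bot_iff.mpr fun q hq => ?_
  obtain ⟨x, rfl⟩ := (trad A X).mkQ_surjective q
  refine (Submodule.Quotient.mk_eq_zero _).mpr (mem_trad_iff.mpr fun M hcl hM => ?_)
  have hle : trad A X ≤ M := fun y hy => mem_trad_iff.mp hy M hcl hM
  have hcomap : (M.map (trad A X).mkQ).comap (trad A X).mkQ = M := by
    rw [Submodule.comap_map_mkQ, sup_eq_right.mpr hle]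
  have hM' : IsCoatom (M.map (trad A X).mkQ) :=
    Submodule.isCoatom_map_of_ker_le (trad A X).mkQ_surjective (by simpa using hle) hM
  have hcl' : IsClosed (M.map (trad A X).mkQ : Set (X ⧸ trad A X)) := by
    rw [← (trad A X).isQuotientMap_mkQ.isClosed_preimage]
    change IsClosed (((M.map (trad A X).mkQ).comap (trad A X).mkQ : Submodule A X) : Set X)
    rwa [hcomap]
  rw [← hcomap]
  exact mem_trad_iff.mp hq _ hcl' hM'

theorem trad_le_of_trad_quotient_eq_bot (Z : Submodule A X) [IsClosed (Z : Set X)]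
    (h : trad A (X ⧸ Z) = ⊥) : trad A X ≤ Z := by
  have := Z.isBoundedSMul_quotient
  intro x hx
  have hq : Z.mkQL x ∈ trad A (X ⧸ Z) := map_mem_trad Z.mkQL hx
  rw [h] at hq
  exact (Submodule.Quotient.mk_eq_zero Z).mp hq

end

theorem mainTheorem2 (A : Type u) [NormedRing A] [NormedAlgebra ℂ A] [CompleteSpace A]
    (X : Type v) [NormedAddCommGroup X] [NormedSpace ℂ X] [CompleteSpace X]
    [Module A X] [IsScalarTower ℂ A X] [IsBoundedSMul A X] :
    -- the two descriptions of the topological radical agree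
    (trad A X : Set X) = smallRangeUnion A X ∧
    -- (1)
    (∀ (Y : Type w) [NormedAddCommGroup Y] [NormedSpace ℂ Y] [CompleteSpace Y]
      [Module A Y] [IsScalarTower ℂ A Y] [IsBoundedSMul A Y] (φ : X →L[A] Y),
      φ '' (trad A X : Set X) ⊆ (trad A Y : Set Y)) ∧
    -- (2)
    (∀ x₀ : X, IsSmallMorphism (ContinuousLinearMap.toSpanSingleton A x₀) ↔ x₀ ∈ trad A X) ∧
    -- (3)
    closure ((Ring.jacobson A • (⊤ : Submodule A X) : Submodule A X) : Set X) ⊆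
      (trad A X : Set X) ∧
    -- (4), including that the topological radical is closed
    (∃ _ : IsClosed (trad A X : Set X), trad A (X ⧸ trad A X) = ⊥) ∧
    -- (5)
    (∀ (Z : Submodule A X) [IsClosed (Z : Set X)], trad A (X ⧸ Z) = ⊥ → trad A X ≤ Z) := by
  exact ⟨coe_trad_eq_smallRangeUnion,
    fun Y _ _ _ _ _ _ φ => Set.image_subset_iff.mpr fun _ hx => map_mem_trad φ hx,
    fun x₀ => isSmallMorphism_toSpanSingleton_iff,
    closure_minimal jacobson_smul_top_le_trad isClosed_trad,
    ⟨isClosed_trad, have := isClosed_trad (A := A) (X := X); trad_quotient_trad⟩,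
    fun Z _ h => trad_le_of_trad_quotient_eq_bot Z h⟩
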